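/- Let $G$ be a finite simple graph with at least one vertex, and suppose that either $G$ is bipartite or no connected component of $G$ is bipartite (in particular, $G$ may be any connected graph). Let $Q=D+A$ be the signless Laplacian matrix of $G$, where $D$ is the diagonal matrix of vertex degrees and $A$ is the adjacency matrix of $G$, and let $\mathrm{oc}(G)$ be the number of odd cycles in $G$, where a cycle is counted as a subgraph. Then $$\mathrm{oc}(G)\le \frac{\det(Q)}{4},$$ and equality holds if and only if $G$ is bipartite or odd-unicyclic. Here $G$ is called odd-unicyclic if it is connected and contains exactly one cycle, and this cycle has odd length. -/

import Mathlib

namespace SimpleGraph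

/-- The signless Laplacian matrix `Q = D + A` of a simple graph. -/
def signlessLapMatrix {V : Type*} [Fintype V] [DecidableEq V] (G : SimpleGraph V)
    [DecidableRel G.Adj] (R : Type*) [AddMonoidWithOne R] : Matrix V V R :=
  G.degMatrix R + G.adjMatrix R

/-- A subgraph `C` of `G` is a cycle: it consists of the vertices and edges traversed by a closed
walk that repeats no edge, and no vertex other than its base point. -/
def IsCycleSubgraph {V : Type*} (G : SimpleGraph V) (C : G.Subgraph) : Prop :=
  ∃ (v : V) (w : G.Walk v v), w.IsCycle ∧ w.toSubgraph = C

/-- A subgraph `C` of `G` is a cycle of odd length. -/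
def IsOddCycleSubgraph {V : Type*} (G : SimpleGraph V) (C : G.Subgraph) : Prop :=
  ∃ (v : V) (w : G.Walk v v), w.IsCycle ∧ Odd w.length ∧ w.toSubgraph = C

/-- The number of odd cycles of `G`, a cycle being counted once, as a subgraph (independently of
starting point and direction). -/
noncomputable def numOddCycles {V : Type*} (G : SimpleGraph V) : ℕ :=
  {C : G.Subgraph | G.IsOddCycleSubgraph C}.ncard

/-- A graph is odd-unicyclic if it is connected, and has exactly one cycle, which is odd. -/
def IsOddUnicyclic {V : Type*} (G : SimpleGraph V) : Prop :=
  G.Connected ∧ ∃ C : G.Subgraph, G.IsOddCycleSubgraph C ∧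
    ∀ C' : G.Subgraph, G.IsCycleSubgraph C' → C' = C

end SimpleGraph

namespace Matrix

open Finset

/-! Write `Q = B * Bᵀ` with `B` the unsigned incidence matrix. By Cauchy–Binet, `det Q` is the sum
of `det(B_S)^2` over the column bases `S`. Modulo 2, the kernel vectors of `B_S` are the even
subsets of `S`, and there are at most `|det B_S|` of them (`card_ker_mod_two_le`). Odd cycles are
even sets of odd size, so they make up at most half of these. If `S` contains `c` odd cycles, then
`4c ≤ (2c)^2 ≤ det(B_S)^2`. When no component is bipartite, each odd cycle extends to a basis, and
summing over bases gives the bound.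

Equality forces each basis to contain exactly one odd cycle and each odd cycle to lie in a unique
basis. An edge `f` outside a basis `S` would yield, by exchange, two further bases inside `S ∪ {f}`,
hence three odd cycles there; the parity count allows only two (`mem_of_four_mul_card_eq_det`). So
`S` is the whole edge set and there is one cycle. Connectedness follows from `|det B_S| = 2`.
Conversely, an odd-unicyclic graph has `det Q ≤ 4` by `det_dvd_two`. In the bipartite case both
sides vanish. -/

theorem exists_injective_image_eq {V E : Type*} [Fintype V] [DecidableEq E] {S : Finset E} (hS : #S = Fintype.card V) :
    ∃ p : V → E, Function.Injective p ∧ univ.image p = S := by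
  have e : V ≃ S := Fintype.equivOfCardEq (by simp [hS])
  refine ⟨fun v => e v, Subtype.val_injective.comp e.injective, ?_⟩
  ext x
  simp only [mem_image, mem_univ, true_and]
  exact ⟨fun ⟨v, hv⟩ => hv ▸ (e v).2, fun hx => ⟨e.symm ⟨x, hx⟩, by simp⟩⟩

variable {V E : Type*} [Fintype V] [DecidableEq V]

/-! ### Cauchy–Binet for Gram determinants. -/

section CauchyBinet

variable {R : Type*} [CommRing R]

theorem det_mul_transpose_eq_sum_fun [Fintype E] (A : Matrix V E R) :
    (A * Aᵀ).det = ∑ p : V → E, (A.submatrix id p).det * ∏ i, A i (p i) := by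
  classical
  simp only [det_apply', mul_apply, prod_univ_sum, mul_sum, Fintype.piFinset_univ, sum_mul]
  rw [Finset.sum_comm]
  refine sum_congr rfl fun p _ => sum_congr rfl fun σ _ => ?_
  simp [prod_mul_distrib, mul_assoc]

/-- The Gram determinant of the columns of `A` indexed by `S`. -/
noncomputable def gramMinor (A : Matrix V E R) (S : Finset E) : R :=
  (A.submatrix id (fun e : S => (e : E)) * (A.submatrix id (fun e : S => (e : E)))ᵀ).det

theorem gramMinor_eq_sum [Fintype E] [DecidableEq E] (A : Matrix V E R) (S : Finset E) :
    A.gramMinor S =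
      ∑ p : V → E with ∀ i, p i ∈ S, (A.submatrix id p).det * ∏ i, A i (p i) := by
  rw [gramMinor, det_mul_transpose_eq_sum_fun]
  refine sum_bij (fun (p : V → S) _ i => (p i : E)) ?_ ?_ ?_ ?_
  · simp
  · intro p _ q _ h
    ext i
    exact congrFun h i
  · intro p hp
    simp only [mem_filter, mem_univ, true_and] at hp
    exact ⟨fun i => ⟨p i, hp i⟩, mem_univ _, rfl⟩
  · intro p _
    rfl

/-- The Cauchy–Binet formula for `A * Aᵀ`. -/
theorem det_mul_transpose_eq_sum_gramMinor [Fintype E] [DecidableEq E] (A : Matrix V E R) :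
    (A * Aᵀ).det = ∑ S ∈ powersetCard (Fintype.card V) univ, A.gramMinor S := by
  have hzero : ∀ p : V → E, ¬ Function.Injective p → (A.submatrix id p).det = 0 := by
    intro p hp
    simp only [Function.Injective, not_forall] at hp
    obtain ⟨i, j, hij, hne⟩ := hp
    exact det_zero_of_column_eq hne fun k => by simp [hij]
  -- Non-injective selections repeat a column and vanish; the injective ones are grouped by their
  -- image.
  rw [det_mul_transpose_eq_sum_fun, ← sum_filter_add_sum_filter_not univ Function.Injective,
    add_eq_left.2 (sum_eq_zero fun p hp => by rw [hzero p (mem_filter.1 hp).2, zero_mul]),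
    ← sum_fiberwise_of_maps_to (g := fun p => univ.image p)
      (t := powersetCard (Fintype.card V) univ)]
  · refine sum_congr rfl fun S hS => ?_
    rw [gramMinor_eq_sum]
    have hcard := (mem_powersetCard.1 hS).2
    refine sum_subset_zero_on_sdiff ?_ ?_ fun _ _ => rfl
    · intro p hp
      simp only [mem_filter, mem_univ, true_and] at hp ⊢
      intro i
      rw [← hp.2]
      exact mem_image_of_mem _ (mem_univ _)
    · intro p hp
      simp only [mem_sdiff, mem_filter, mem_univ, true_and, not_and] at hp
      rw [hzero p fun hinj => hp.2 hinj ?_, zero_mul]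
      refine eq_of_subset_of_card_le (fun e he => ?_) ?_
      · obtain ⟨i, -, rfl⟩ := mem_image.1 he
        exact hp.1 i
      · rw [card_image_of_injective _ hinj, hcard, card_univ]
  · intro p hp
    rw [mem_powersetCard, card_image_of_injective _ (mem_filter.1 hp).2]
    exact ⟨subset_univ _, card_univ⟩

/-- An enumeration of `S` changes the minor only by a sign, which the square forgets; this lets
`gramMinor` avoid ordering the columns. -/
theorem gramMinor_eq_det_sq [DecidableEq E] (A : Matrix V E R) {S : Finset E} {p : V → E}
    (hp : Function.Injective p) (hS : univ.image p = S) :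
    A.gramMinor S = (A.submatrix id p).det ^ 2 := by
  have hmem : ∀ i, p i ∈ S := fun i => hS ▸ mem_image_of_mem _ (mem_univ i)
  let σ : V ≃ S := Equiv.ofBijective (fun i => ⟨p i, hmem i⟩)
    ⟨fun i j h => hp (congrArg Subtype.val h), fun e => by
      obtain ⟨i, -, hi⟩ := mem_image.1 (hS.symm ▸ e.2 : (e : E) ∈ univ.image p)
      exact ⟨i, Subtype.ext hi⟩⟩
  have hsq : (A.submatrix id p).det ^ 2 = (A.submatrix id p * (A.submatrix id p)ᵀ).det := by
    rw [det_mul, det_transpose, sq]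
  rw [hsq, gramMinor]
  congr 1
  ext i j
  simp only [mul_apply, submatrix_apply, transpose_apply, id]
  exact (σ.sum_comp fun e : S => A i e * A j e).symm

end CauchyBinet

/-! ### Nullity modulo 2 and divisibility of determinants. -/

section ModTwo

/-- If an integer matrix has nullity `d` modulo `2`, then `2 ^ d` divides its determinant. -/
theorem two_pow_dvd_det (M : Matrix V V ℤ) :
    (2 : ℤ) ^ Module.finrank (ZMod 2)
      (LinearMap.ker (M.map (Int.cast : ℤ → ZMod 2)).mulVecLin) ∣ M.det := by
  classical
  set Mb := M.map (Int.cast : ℤ → ZMod 2) with hMb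
  set K := LinearMap.ker Mb.mulVecLin
  obtain ⟨C, hC⟩ := K.exists_isCompl
  let b₀ := ((Module.finBasis (ZMod 2) K).prod (Module.finBasis (ZMod 2) C)).map
    (Submodule.prodEquivOfIsCompl K C hC)
  let e := b₀.indexEquiv (Pi.basisFun (ZMod 2) V)
  let b := b₀.reindex e
  -- An integer lift of a basis adapted to the kernel and a complement. Its determinant is odd, and
  -- each kernel column of `M * P` is divisible by 2.
  let P : Matrix V V ℤ := of fun v j => ((b j v).val : ℤ)
  have hP : P.map (Int.cast : ℤ → ZMod 2) = (Pi.basisFun (ZMod 2) V).toMatrix b := by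
    ext v j
    simp [P, Module.Basis.toMatrix_apply]
  have hPdet : ((P.det : ℤ) : ZMod 2) ≠ 0 := by
    rw [Int.cast_det, show P.map (fun x : ℤ => (x : ZMod 2)) = _ from hP]
    have := (Pi.basisFun (ZMod 2) V).isUnit_det b
    exact this.ne_zero
  let t : V → ℤ := fun j => Sum.elim (fun _ => 2) (fun _ => 1) (e.symm j)
  have hdvd : ∀ v j, t j ∣ (M * P) v j := by
    intro v j
    rcases h : e.symm j with k | k
    · have hbj : b j ∈ K := by
        simp [b, b₀, h]
      have h0 : (Mb *ᵥ b j) v = 0 := congrFun (LinearMap.mem_ker.1 hbj) v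
      simp only [t, h, Sum.elim_inl]
      rw [← Nat.cast_ofNat (R := ℤ), ← ZMod.intCast_zmod_eq_zero_iff_dvd, ← h0]
      simp [mul_apply, mulVec, dotProduct, P, Mb]
    · simp [t, h]
  choose N hN using hdvd
  have hMP : M * P = of N * diagonal t := by
    ext v j
    rw [mul_diagonal, hN, mul_comm]
    rfl
  have hprod : ∏ j, t j = 2 ^ Module.finrank (ZMod 2) K := by
    rw [← e.prod_comp]
    simp [t]
  have hmain : (2 : ℤ) ^ Module.finrank (ZMod 2) K ∣ M.det * P.det := by
    rw [← det_mul, hMP, det_mul, det_diagonal, hprod]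
    exact dvd_mul_left _ _
  refine IsCoprime.dvd_of_dvd_mul_right (IsCoprime.pow_left ?_) hmain
  rw [Int.prime_two.irreducible.coprime_iff_not_dvd]
  exact fun h => hPdet ((ZMod.intCast_zmod_eq_zero_iff_dvd _ 2).2 (by exact_mod_cast h))

/-- A nonsingular integer matrix has at most `|det M|` kernel vectors modulo `2`. -/
theorem card_ker_mod_two_le (M : Matrix V V ℤ) (hM : M.det ≠ 0) :
    #{y : V → ZMod 2 | M.map (Int.cast : ℤ → ZMod 2) *ᵥ y = 0} ≤ M.det.natAbs := by
  classical
  have h := Int.natAbs_dvd_natAbs.2 M.two_pow_dvd_det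
  rw [Int.natAbs_pow] at h
  refine le_trans (le_of_eq ?_) (Nat.le_of_dvd (Int.natAbs_pos.2 hM) h)
  have := Module.card_eq_pow_finrank (K := ZMod 2)
    (V := LinearMap.ker (M.map (Int.cast : ℤ → ZMod 2)).mulVecLin)
  rw [ZMod.card] at this
  rw [show (2 : ℤ).natAbs = 2 from rfl, ← this, Fintype.card_subtype]
  congr 1
  ext y
  simp

end ModTwo

end Matrix

/-! ### Even sets of columns, column bases and the weighted count. -/

namespace Matrix

open Finset

theorem two_dvd_sum_symmDiff_iff {E : Type*} [DecidableEq E] {T T' : Finset E} {f : E → ℤ} (h : 2 ∣ ∑ e ∈ T', f e) :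
    2 ∣ ∑ e ∈ symmDiff T T', f e ↔ 2 ∣ ∑ e ∈ T, f e := by
  have h1 : ∑ e ∈ symmDiff T T', f e = ∑ e ∈ T \ T', f e + ∑ e ∈ T' \ T, f e :=
    sum_union disjoint_sdiff_sdiff
  have h2 := sum_inter_add_sum_sdiff T T' f
  have h3 := sum_inter_add_sum_sdiff T' T f
  rw [inter_comm] at h3
  omega

theorem even_card_symmDiff {E : Type*} [DecidableEq E] {T T' : Finset E} (h : Odd #T) (h' : Odd #T') :
    ¬ Odd #(symmDiff T T') := by
  have h1 : #(symmDiff T T') = #(T \ T') + #(T' \ T) := card_union_of_disjoint disjoint_sdiff_sdiff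
  have h2 := card_inter_add_card_sdiff T T'
  have h3 := card_inter_add_card_sdiff T' T
  rw [inter_comm] at h3
  rw [Nat.odd_iff] at *
  omega

variable {V E : Type*} [Fintype V]

/-- The subsets `T` of `S` such that every row of `B` has an even sum over `T`. -/
def evenSets (B : Matrix V E ℤ) (S : Finset E) : Finset (Finset E) :=
  {T ∈ S.powerset | ∀ v, 2 ∣ ∑ e ∈ T, B v e}

variable {B : Matrix V E ℤ} {S T T' : Finset E}

theorem mem_evenSets : T ∈ B.evenSets S ↔ T ⊆ S ∧ ∀ v, 2 ∣ ∑ e ∈ T, B v e := by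
  simp [evenSets]

/-- The columns of `B` indexed by `S` form a basis of the column space `ℚ ^ V`. -/
def IsColBasis [DecidableEq V] (B : Matrix V E ℤ) (S : Finset E) : Prop :=
  #S = Fintype.card V ∧ B.gramMinor S ≠ 0

open Classical in
/-- The column bases of `B`. -/
noncomputable def colBases [DecidableEq V] [Fintype E] (B : Matrix V E ℤ) : Finset (Finset E) := {S | B.IsColBasis S}

theorem mem_colBases [DecidableEq V] [Fintype E] : S ∈ B.colBases ↔ B.IsColBasis S := by simp [colBases]

variable [DecidableEq E]

theorem symmDiff_mem_evenSets (h : T ∈ B.evenSets S) (h' : T' ∈ B.evenSets S) :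
    symmDiff T T' ∈ B.evenSets S := by
  rw [mem_evenSets] at *
  exact ⟨union_subset (sdiff_subset.trans h.1) (sdiff_subset.trans h'.1),
    fun v => (two_dvd_sum_symmDiff_iff (h'.2 v)).2 (h.2 v)⟩

/-- Symmetric difference with a fixed odd member injects the odd members into the even ones. -/
theorem two_mul_card_odd_evenSets_le (B : Matrix V E ℤ) (S : Finset E) :
    2 * #{T ∈ B.evenSets S | Odd #T} ≤ #(B.evenSets S) := by
  rcases ({T ∈ B.evenSets S | Odd #T}).eq_empty_or_nonempty with h | ⟨T₀, h₀⟩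
  · simp [h]
  rw [mem_filter] at h₀
  have hle : #{T ∈ B.evenSets S | Odd #T} ≤ #{T ∈ B.evenSets S | ¬ Odd #T} := by
    refine card_le_card_of_injOn (fun T => symmDiff T T₀) (fun T hT => ?_)
      ((symmDiff_left_injective T₀).injOn)
    rw [mem_coe, mem_filter] at hT ⊢
    exact ⟨symmDiff_mem_evenSets hT.1 h₀.1, even_card_symmDiff hT.2 h₀.2⟩
  have := card_filter_add_card_filter_not (s := B.evenSets S) (fun T => Odd #T)
  omega

/-- Symmetric difference with one even set through `f` injects those through `f` into those avoiding
it. -/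
theorem card_evenSets_insert_le (B : Matrix V E ℤ) (S : Finset E) (f : E) :
    #(B.evenSets (insert f S)) ≤ 2 * #(B.evenSets S) := by
  have h1 : #{T ∈ B.evenSets (insert f S) | f ∉ T} ≤ #(B.evenSets S) := by
    refine card_le_card fun T hT => ?_
    rw [mem_filter, mem_evenSets] at hT
    exact mem_evenSets.2 ⟨(subset_insert_iff_of_notMem hT.2).1 hT.1.1, hT.1.2⟩
  have h2 : #{T ∈ B.evenSets (insert f S) | ¬ f ∉ T} ≤ #{T ∈ B.evenSets (insert f S) | f ∉ T} := by
    rcases ({T ∈ B.evenSets (insert f S) | ¬ f ∉ T}).eq_empty_or_nonempty with h | ⟨T₀, h₀⟩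
    · rw [h, card_empty]
      exact Nat.zero_le _
    rw [mem_filter] at h₀
    refine card_le_card_of_injOn (fun T => symmDiff T T₀) (fun T hT => ?_)
      ((symmDiff_left_injective T₀).injOn)
    rw [mem_coe, mem_filter] at hT ⊢
    refine ⟨symmDiff_mem_evenSets hT.1 h₀.1, ?_⟩
    have := hT.2
    have := h₀.2
    rw [mem_symmDiff]
    tauto
  have := card_filter_add_card_filter_not (s := B.evenSets (insert f S)) (fun T => f ∉ T)
  omega

theorem card_filter_subset_le {C : Finset (Finset E)} (hodd : ∀ T ∈ C, Odd #T)
    (heven : ∀ T ∈ C, ∀ v, 2 ∣ ∑ e ∈ T, B v e) (S : Finset E) :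
    2 * #{T ∈ C | T ⊆ S} ≤ #(B.evenSets S) := by
  refine le_trans (Nat.mul_le_mul_left 2 (card_le_card fun T hT => ?_))
    (B.two_mul_card_odd_evenSets_le S)
  rw [mem_filter] at hT
  exact mem_filter.2 ⟨mem_evenSets.2 ⟨hT.2, heven T hT.1⟩, hodd T hT.1⟩

variable [DecidableEq V]

/-- The indicator vector of an even set lies in the kernel of the square submatrix modulo 2. -/
theorem card_evenSets_le_natAbs_det {p : V → E} (hp : Function.Injective p)
    (hS : univ.image p = S) (h0 : (B.submatrix id p).det ≠ 0) :
    #(B.evenSets S) ≤ (B.submatrix id p).det.natAbs := by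
  refine le_trans ?_ (card_ker_mod_two_le _ h0)
  refine card_le_card_of_injOn (fun T i => if p i ∈ T then 1 else 0) (fun T hT => ?_) ?_
  · rw [mem_coe, mem_evenSets] at hT
    rw [mem_coe, mem_filter]
    refine ⟨mem_univ _, funext fun v => ?_⟩
    have h : ∑ e ∈ T, B v e = ∑ i, if p i ∈ T then B v (p i) else 0 := by
      rw [← sum_image (f := fun e => if e ∈ T then B v e else 0) hp.injOn, hS, ← sum_filter,
        filter_mem_eq_inter, inter_eq_right.2 hT.1]
    have h2 := (ZMod.intCast_zmod_eq_zero_iff_dvd _ 2).2 (by exact_mod_cast hT.2 v)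
    rw [h] at h2
    push_cast at h2
    simpa [mulVec, dotProduct] using h2
  · intro T hT T' hT' h
    rw [mem_coe, mem_evenSets] at hT hT'
    ext e
    have key : ∀ i, p i ∈ T ↔ p i ∈ T' := fun i => by
      have := congrFun h i
      by_cases h1 : p i ∈ T <;> by_cases h2 : p i ∈ T' <;> simp_all
    constructor
    · intro he
      obtain ⟨i, -, rfl⟩ := mem_image.1 (hS.symm ▸ hT.1 he : e ∈ univ.image p)
      exact (key i).1 he
    · intro he
      obtain ⟨i, -, rfl⟩ := mem_image.1 (hS.symm ▸ hT'.1 he : e ∈ univ.image p)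
      exact (key i).2 he

theorem IsColBasis.exists_fun (h : B.IsColBasis S) :
    ∃ p : V → E, Function.Injective p ∧ univ.image p = S ∧ (B.submatrix id p).det ≠ 0 := by
  obtain ⟨p, hp, hS⟩ := exists_injective_image_eq h.1
  refine ⟨p, hp, hS, fun h0 => h.2 ?_⟩
  rw [gramMinor_eq_det_sq B hp hS, h0, zero_pow two_ne_zero]

theorem isColBasis_of_fun {p : V → E} (hp : Function.Injective p)
    (h0 : (B.submatrix id p).det ≠ 0) : B.IsColBasis (univ.image p) := by
  refine ⟨by rw [card_image_of_injective _ hp, card_univ], ?_⟩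
  rw [gramMinor_eq_det_sq B hp rfl]
  exact pow_ne_zero 2 h0

theorem gramMinor_nonneg (hS : #S = Fintype.card V) : 0 ≤ B.gramMinor S := by
  obtain ⟨p, hp, hS⟩ := exists_injective_image_eq hS
  rw [gramMinor_eq_det_sq B hp hS]
  exact sq_nonneg _

theorem IsColBasis.sq_card_evenSets_le (h : B.IsColBasis S) :
    (#(B.evenSets S) : ℤ) ^ 2 ≤ B.gramMinor S := by
  obtain ⟨p, hp, hS, h0⟩ := h.exists_fun
  rw [gramMinor_eq_det_sq B hp hS, ← Int.natAbs_sq (B.submatrix id p).det]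
  have := card_evenSets_le_natAbs_det hp hS h0
  exact_mod_cast Nat.pow_le_pow_left this 2

/-- If column `f` is not proportional to any column of a basis `S`, then at least two columns of
`S` can be exchanged for `f`. -/
theorem IsColBasis.exists_exchange (h : B.IsColBasis S) {f : E} (hf : f ∉ S)
    (hpar : ∀ e ∈ S, ∃ v, B v e = 0 ∧ B v f ≠ 0) (hf0 : ∃ v, B v f ≠ 0) :
    ∃ e₁ ∈ S, ∃ e₂ ∈ S, e₁ ≠ e₂ ∧ B.IsColBasis (insert f (S.erase e₁)) ∧
      B.IsColBasis (insert f (S.erase e₂)) := by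
  obtain ⟨p, hp, rfl, h0⟩ := h.exists_fun
  set M := B.submatrix id p
  -- Cramer's rule: up to the factor `det M`, the `c i` are the coordinates of column `f` in the
  -- basis, and `c j` is the determinant after exchanging `p j` for `f`. So each nonzero `c j` gives
  -- an exchange.
  set c := M.cramer fun v => B v f
  have hmul : ∀ v, ∑ i, B v (p i) * c i = M.det * B v f := fun v =>
    congrFun (M.mulVec_cramer fun v => B v f) v
  have hfp : ∀ i, p i ≠ f := fun i hi => hf (hi ▸ mem_image_of_mem _ (mem_univ i))
  have hbasis : ∀ j, c j ≠ 0 → B.IsColBasis (insert f ((univ.image p).erase (p j))) := by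
    intro j hj
    have hinj : Function.Injective (Function.update p j f) := by
      intro a b hab
      by_cases ha : a = j <;> by_cases hb : b = j
      · rw [ha, hb]
      · subst ha
        rw [Function.update_self, Function.update_of_ne hb] at hab
        exact (hfp b hab.symm).elim
      · subst hb
        rw [Function.update_self, Function.update_of_ne ha] at hab
        exact (hfp a hab).elim
      · rw [Function.update_of_ne ha, Function.update_of_ne hb] at hab
        exact hp hab
    have hdet : (B.submatrix id (Function.update p j f)).det ≠ 0 := by
      convert hj
      rw [show c j = (M.updateCol j fun v => B v f).det from cramer_apply _ _ _]
      congr 1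
      ext v i
      by_cases hi : i = j
      · subst hi
        simp
      · simp [M, Function.update_of_ne hi, updateCol_ne hi]
    convert isColBasis_of_fun hinj hdet
    ext e
    simp only [mem_insert, mem_erase, mem_image, mem_univ, true_and]
    constructor
    · rintro (rfl | ⟨h1, i, rfl⟩)
      · exact ⟨j, by simp⟩
      · exact ⟨i, Function.update_of_ne (fun hij => h1 (congrArg p hij)) _ _⟩
    · rintro ⟨i, rfl⟩
      by_cases hi : i = j
      · subst hi
        simp
      · rw [Function.update_of_ne hi]
        exact Or.inr ⟨fun hij => hi (hp hij), i, rfl⟩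
  obtain ⟨j, hj⟩ : ∃ j, c j ≠ 0 := by
    by_contra! hc
    obtain ⟨v, hv⟩ := hf0
    exact mul_ne_zero h0 hv ((hmul v).symm.trans (by simp [hc]))
  -- With a single nonzero coordinate, column `f` would be proportional to column `p j`, against
  -- `hpar`.
  obtain ⟨k, hkj, hk⟩ : ∃ k, k ≠ j ∧ c k ≠ 0 := by
    by_contra! hc
    obtain ⟨v, hv1, hv2⟩ := hpar (p j) (mem_image_of_mem _ (mem_univ j))
    refine mul_ne_zero h0 hv2 ((hmul v).symm.trans (sum_eq_zero fun i _ => ?_))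
    by_cases hi : i = j
    · rw [hi, hv1, zero_mul]
    · rw [hc i hi, mul_zero]
  exact ⟨p k, mem_image_of_mem _ (mem_univ k), p j, mem_image_of_mem _ (mem_univ j), hp.ne hkj,
    hbasis k hk, hbasis j hj⟩

/-- For `c` members inside `S`, `2c ≤ #(B.evenSets S)` and the square of the latter is at most the
minor; then `c ≤ c^2`. -/
theorem IsColBasis.four_mul_card_filter_le {C : Finset (Finset E)} (h : B.IsColBasis S)
    (hodd : ∀ T ∈ C, Odd #T)
    (heven : ∀ T ∈ C, ∀ v, 2 ∣ ∑ e ∈ T, B v e) :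
    4 * (#{T ∈ C | T ⊆ S} : ℤ) ≤ B.gramMinor S := by
  have h1 := card_filter_subset_le hodd heven S
  have h2 := h.sq_card_evenSets_le
  zify at h1
  rcases Nat.eq_zero_or_pos (#{T ∈ C | T ⊆ S}) with h0 | h0
  · rw [h0]
    simpa using gramMinor_nonneg h.1
  · zify at h0
    nlinarith

/-- Equality forces `c^2 ≤ c`, while the nonzero minor excludes `c = 0`. -/
theorem IsColBasis.eq_one_of_four_mul_eq {C : Finset (Finset E)} (h : B.IsColBasis S)
    (hodd : ∀ T ∈ C, Odd #T)
    (heven : ∀ T ∈ C, ∀ v, 2 ∣ ∑ e ∈ T, B v e)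
    (heq : 4 * (#{T ∈ C | T ⊆ S} : ℤ) = B.gramMinor S) : #{T ∈ C | T ⊆ S} = 1 := by
  have h1 := card_filter_subset_le hodd heven S
  have h2 := h.sq_card_evenSets_le
  have h3 := h.2
  zify at h1 ⊢
  rw [← heq] at h2 h3
  have h0 : (0 : ℤ) < #{T ∈ C | T ⊆ S} := by
    refine lt_of_le_of_ne (by positivity) fun h0 => h3 (by rw [← h0]; simp)
  nlinarith

variable [Fintype E] {C : Finset (Finset E)}

theorem det_mul_transpose_eq_sum_colBases (B : Matrix V E ℤ) :
    (B * Bᵀ).det = ∑ S ∈ B.colBases, B.gramMinor S := by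
  rw [det_mul_transpose_eq_sum_gramMinor]
  symm
  refine sum_subset (fun S hS => ?_) fun S hS hS' => ?_
  · exact mem_powersetCard.2 ⟨subset_univ _, (mem_colBases.1 hS).1⟩
  · by_contra h
    exact hS' (mem_colBases.2 ⟨(mem_powersetCard.1 hS).2, h⟩)

theorem sum_card_filter_colBases (B : Matrix V E ℤ) (C : Finset (Finset E)) :
    ∑ S ∈ B.colBases, #{T ∈ C | T ⊆ S} = ∑ T ∈ C, #{S ∈ B.colBases | T ⊆ S} := by
  simp only [card_filter]
  exact sum_comm

theorem card_le_sum_colBases (hbasis : ∀ T ∈ C, ∃ S, B.IsColBasis S ∧ T ⊆ S) :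
    #C ≤ ∑ S ∈ B.colBases, #{T ∈ C | T ⊆ S} := by
  rw [sum_card_filter_colBases, card_eq_sum_ones]
  refine sum_le_sum fun T hT => card_pos.2 ?_
  obtain ⟨S, hS, hTS⟩ := hbasis T hT
  exact ⟨S, mem_filter.2 ⟨mem_colBases.2 hS, hTS⟩⟩

theorem four_mul_card_le_det (hodd : ∀ T ∈ C, Odd #T)
    (heven : ∀ T ∈ C, ∀ v, 2 ∣ ∑ e ∈ T, B v e)
    (hbasis : ∀ T ∈ C, ∃ S, B.IsColBasis S ∧ T ⊆ S) :
    4 * (#C : ℤ) ≤ (B * Bᵀ).det := by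
  have h := card_le_sum_colBases hbasis
  zify at h
  rw [det_mul_transpose_eq_sum_colBases]
  calc 4 * (#C : ℤ) ≤ ∑ S ∈ B.colBases, 4 * (#{T ∈ C | T ⊆ S} : ℤ) := by
        rw [← mul_sum]
        linarith
    _ ≤ _ := sum_le_sum fun S hS => (mem_colBases.1 hS).four_mul_card_filter_le hodd heven

/-- In the case of equality in `four_mul_card_le_det`, each basis contains exactly one member of
the family, and each member of the family is contained in exactly one basis. -/
theorem of_four_mul_card_eq_det (hodd : ∀ T ∈ C, Odd #T)
    (heven : ∀ T ∈ C, ∀ v, 2 ∣ ∑ e ∈ T, B v e)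
    (hbasis : ∀ T ∈ C, ∃ S, B.IsColBasis S ∧ T ⊆ S) (heq : 4 * (#C : ℤ) = (B * Bᵀ).det) :
    (∀ S, B.IsColBasis S → #{T ∈ C | T ⊆ S} = 1 ∧ B.gramMinor S = 4) ∧
      ∀ T ∈ C, ∀ S S', B.IsColBasis S → B.IsColBasis S' → T ⊆ S → T ⊆ S' → S = S' := by
  have hle : ∀ S ∈ B.colBases, 4 * (#{T ∈ C | T ⊆ S} : ℤ) ≤ B.gramMinor S :=
    fun S hS => (mem_colBases.1 hS).four_mul_card_filter_le hodd heven
  have h := card_le_sum_colBases hbasis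
  have h' : (#C : ℤ) ≤ ∑ S ∈ B.colBases, (#{T ∈ C | T ⊆ S} : ℤ) := by exact_mod_cast h
  have h2 := sum_le_sum hle
  rw [← det_mul_transpose_eq_sum_colBases, ← heq, ← mul_sum] at h2
  have hsum : (#C : ℤ) = ∑ S ∈ B.colBases, (#{T ∈ C | T ⊆ S} : ℤ) := by linarith
  have hterm := (sum_eq_sum_iff_of_le hle).1 (by
    rw [← det_mul_transpose_eq_sum_colBases, ← heq, ← mul_sum, hsum])
  constructor
  · intro S hS
    have h4 := hterm S (mem_colBases.2 hS)
    have h1 := hS.eq_one_of_four_mul_eq hodd heven h4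
    exact ⟨h1, by rw [← h4, h1]; rfl⟩
  · intro T hT S S' hS hS' hTS hTS'
    have hcount : ∑ T ∈ C, 1 = ∑ T ∈ C, #{S ∈ B.colBases | T ⊆ S} := by
      rw [← sum_card_filter_colBases, ← card_eq_sum_ones]
      exact_mod_cast hsum
    have hone := (sum_eq_sum_iff_of_le (fun T hT => by
      obtain ⟨S, hS, hTS⟩ := hbasis T hT
      exact card_pos.2 ⟨S, mem_filter.2 ⟨mem_colBases.2 hS, hTS⟩⟩)).1 hcount T hT
    exact card_le_one.1 hone.ge S (mem_filter.2 ⟨mem_colBases.2 hS, hTS⟩)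
      S' (mem_filter.2 ⟨mem_colBases.2 hS', hTS'⟩)

/-- In the case of equality in `four_mul_card_le_det`, if no two nonzero columns are proportional,
every basis contains all nonzero columns. -/
theorem mem_of_four_mul_card_eq_det (hodd : ∀ T ∈ C, Odd #T)
    (heven : ∀ T ∈ C, ∀ v, 2 ∣ ∑ e ∈ T, B v e)
    (hbasis : ∀ T ∈ C, ∃ S, B.IsColBasis S ∧ T ⊆ S) (heq : 4 * (#C : ℤ) = (B * Bᵀ).det)
    (hpar : ∀ f, (∃ v, B v f ≠ 0) → ∀ e ≠ f, ∃ v, B v e = 0 ∧ B v f ≠ 0)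
    (hS : B.IsColBasis S) {f : E} (hf0 : ∃ v, B v f ≠ 0) : f ∈ S := by
  by_contra hf
  obtain ⟨hone, huniq⟩ := of_four_mul_card_eq_det hodd heven hbasis heq
  obtain ⟨e₁, he₁, e₂, he₂, hne, h₁, h₂⟩ :=
    hS.exists_exchange hf (fun e he => hpar f hf0 e fun h => hf (h ▸ he)) hf0
  have hpick : ∀ S, B.IsColBasis S → ∃ T ∈ C, T ⊆ S := fun S hS => by
    obtain ⟨T, hT⟩ := card_pos.1 ((hone S hS).1 ▸ one_pos)
    exact ⟨T, (mem_filter.1 hT).1, (mem_filter.1 hT).2⟩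
  have hK : #(B.evenSets S) ≤ 2 := by
    have := hS.sq_card_evenSets_le
    rw [(hone S hS).2] at this
    zify
    nlinarith
  have hodd2 := card_filter_subset_le hodd heven (insert f S)
  have hins := B.card_evenSets_insert_le S f
  obtain ⟨T₀, hT₀, hs₀⟩ := hpick _ hS
  obtain ⟨T₁, hT₁, hs₁⟩ := hpick _ h₁
  obtain ⟨T₂, hT₂, hs₂⟩ := hpick _ h₂
  have hsub : ∀ e, insert f (S.erase e) ⊆ insert f S := fun e =>
    insert_subset_insert _ (erase_subset _ _)
  have h01 : T₀ ≠ T₁ := by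
    rintro rfl
    exact hf (huniq _ hT₀ _ _ hS h₁ hs₀ hs₁ ▸ mem_insert_self _ _)
  have h02 : T₀ ≠ T₂ := by
    rintro rfl
    exact hf (huniq _ hT₀ _ _ hS h₂ hs₀ hs₂ ▸ mem_insert_self _ _)
  have h12 : T₁ ≠ T₂ := by
    rintro rfl
    have := huniq _ hT₁ _ _ h₁ h₂ hs₁ hs₂
    have he : e₁ ∈ insert f (S.erase e₁) := this ▸ mem_insert_of_mem (mem_erase.2 ⟨hne, he₁⟩)
    rcases mem_insert.1 he with h | h
    · exact hf (h ▸ he₁)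
    · exact notMem_erase _ _ h
  -- Three odd members inside `insert f S` need at least six even sets there, but `hK` and `hins`
  -- allow only four.
  have h3 : #{T₀, T₁, T₂} ≤ #{T ∈ C | T ⊆ insert f S} := card_le_card fun T hT => by
    simp only [mem_insert, mem_singleton] at hT
    rcases hT with rfl | rfl | rfl
    · exact mem_filter.2 ⟨hT₀, hs₀.trans (subset_insert _ _)⟩
    · exact mem_filter.2 ⟨hT₁, hs₁.trans (hsub _)⟩
    · exact mem_filter.2 ⟨hT₂, hs₂.trans (hsub _)⟩
  rw [card_eq_three.2 ⟨T₀, T₁, T₂, h01, h02, h12, rfl⟩] at h3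
  omega

end Matrix

/-! ### Extending independent columns to a basis. -/

namespace Matrix

open Finset

variable {V E : Type*} [Fintype V] [DecidableEq V] [DecidableEq E] {B : Matrix V E ℤ}

theorem IsColBasis.exists_ne_zero {S : Finset E} (h : B.IsColBasis S) {e : E} (he : e ∈ S) :
    ∃ v, B v e ≠ 0 := by
  obtain ⟨p, hp, rfl, h0⟩ := h.exists_fun
  obtain ⟨i, -, rfl⟩ := mem_image.1 he
  by_contra! hz
  exact h0 (det_eq_zero_of_column_eq_zero i hz)

variable [Fintype E]

/-- If the columns of `B` span, then every independent set of columns extends to a basis. -/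
theorem exists_isColBasis_of_linearIndepOn {T : Finset E}
    (hT : LinearIndepOn ℚ (fun e v => (B v e : ℚ)) (T : Set E))
    (hspan : Submodule.span ℚ (Set.range fun e v => (B v e : ℚ)) = ⊤) :
    ∃ S, B.IsColBasis S ∧ T ⊆ S := by
  classical
  obtain ⟨b, -, hTb, hb, hind⟩ := exists_linearIndepOn_extension hT (Set.subset_univ _)
  lift b to Finset E using b.toFinite
  have htop : Submodule.span ℚ (Set.range fun e : b => fun v => (B v e : ℚ)) = ⊤ := by
    rw [eq_top_iff, ← hspan, Submodule.span_le, ← Set.image_univ]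
    refine hb.trans (le_of_eq ?_)
    rw [Set.image_eq_range]
    rfl
  have hcard : #b = Fintype.card V := by
    have h := finrank_span_eq_card (R := ℚ) (b := fun e : b => fun v => (B v e : ℚ)) hind
    rw [htop, finrank_top, Module.finrank_fintype_fun_eq_card, Fintype.card_coe] at h
    exact h.symm
  refine ⟨b, ⟨hcard, ?_⟩, by simpa using hTb⟩
  obtain ⟨p, hp, hpb⟩ := exists_injective_image_eq hcard
  rw [gramMinor_eq_det_sq B hp hpb]
  refine pow_ne_zero 2 fun h0 => ?_
  have hmem : ∀ i, p i ∈ b := fun i => hpb ▸ mem_image_of_mem _ (mem_univ i)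
  have hcols : LinearIndependent ℚ ((B.submatrix id p).map (Int.cast : ℤ → ℚ)).col :=
    LinearIndependent.comp hind (fun i => ⟨p i, hmem i⟩)
      fun i j h => hp (congrArg Subtype.val h)
  rw [linearIndependent_cols_iff_isUnit, isUnit_iff_isUnit_det] at hcols
  refine hcols.ne_zero ?_
  have := Int.cast_det (R := ℚ) (B.submatrix id p)
  rw [h0, Int.cast_zero] at this
  exact this.symm

end Matrix

/-! ### Odd cycles and the incidence matrix. -/

namespace SimpleGraph

open Finset Matrix

variable {V : Type*} {G : SimpleGraph V}

theorem Walk.IsCycle.toSubgraph_eq_of_edges {u v : V} {w : G.Walk u u} {w' : G.Walk v v}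
    (hw : w.IsCycle) (hw' : w'.IsCycle) (h : ∀ e, e ∈ w.edges ↔ e ∈ w'.edges) :
    w.toSubgraph = w'.toSubgraph := by
  have hs : ∀ x, x ∈ w.support ↔ x ∈ w'.support := fun x => by
    rw [Walk.mem_support_iff_exists_mem_edges_of_not_nil hw.not_nil,
      Walk.mem_support_iff_exists_mem_edges_of_not_nil hw'.not_nil]
    simp only [h]
  refine Subgraph.ext (by ext x; simp [hs]) ?_
  ext a b
  rw [← Subgraph.mem_edgeSet, ← Subgraph.mem_edgeSet, Walk.mem_edges_toSubgraph,
    Walk.mem_edges_toSubgraph, h]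

theorem exists_odd_closed_walk
    (hG : ∀ c : G.ConnectedComponent, ¬ c.toSimpleGraph.IsBipartite) (v : V) :
    ∃ w : G.Walk v v, Odd w.length := by
  have h := hG (G.connectedComponentMk v)
  rw [IsBipartite, two_colorable_iff_forall_loop_even] at h
  push Not at h
  obtain ⟨⟨x, hx⟩, w, hw⟩ := h
  rw [Nat.not_even_iff_odd] at hw
  have hr : G.Reachable v x := (ConnectedComponent.exact hx).symm
  obtain ⟨q⟩ := hr
  let w' : G.Walk x x := w.map (ConnectedComponent.toSimpleGraph_hom _)
  -- Going out and back along `q` adds an even length.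
  refine ⟨(q.append w').append q.reverse, ?_⟩
  have hl : w'.length = w.length := Walk.length_map _ _
  rw [Walk.length_append, Walk.length_append, Walk.length_reverse, hl]
  rw [Nat.odd_iff] at hw ⊢
  omega

variable [DecidableEq V]

/-- The edge sets of the odd cycles of `G`. -/
noncomputable def oddCycleEdgeFinsets [Fintype V] (G : SimpleGraph V) : Finset (Finset (Sym2 V)) :=
  open Classical in
  {T | ∃ (v : V) (w : G.Walk v v), w.IsCycle ∧ Odd w.length ∧ w.edges.toFinset = T}

theorem mem_oddCycleEdgeFinsets [Fintype V] {T : Finset (Sym2 V)} :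
    T ∈ G.oddCycleEdgeFinsets ↔
      ∃ (v : V) (w : G.Walk v v), w.IsCycle ∧ Odd w.length ∧ w.edges.toFinset = T := by
  classical
  simp only [oddCycleEdgeFinsets, mem_filter, mem_univ, true_and]

theorem numOddCycles_eq_card [Fintype V] : G.numOddCycles = #G.oddCycleEdgeFinsets := by
  classical
  rw [numOddCycles, ← Set.ncard_coe_finset]
  refine Set.ncard_congr (fun C _ => C.edgeSet.toFinset) ?_ ?_ ?_
  · rintro _ ⟨v, w, hw, ho, rfl⟩
    rw [mem_coe, mem_oddCycleEdgeFinsets]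
    exact ⟨v, w, hw, ho, by ext e; simp⟩
  · rintro _ _ ⟨v, w, hw, ho, rfl⟩ ⟨v', w', hw', ho', rfl⟩ h
    refine hw.toSubgraph_eq_of_edges hw' fun e => ?_
    have := congrArg (e ∈ ·) h
    simpa using this
  · intro T hT
    obtain ⟨v, w, hw, ho, rfl⟩ := mem_oddCycleEdgeFinsets.1 hT
    exact ⟨w.toSubgraph, ⟨v, w, hw, ho, rfl⟩, by ext e; simp⟩

theorem odd_card_of_mem_oddCycleEdgeFinsets [Fintype V] {T : Finset (Sym2 V)} (hT : T ∈ G.oddCycleEdgeFinsets) : Odd #T := by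
  obtain ⟨v, w, hw, ho, rfl⟩ := mem_oddCycleEdgeFinsets.1 hT
  rwa [List.toFinset_card_of_nodup hw.edges_nodup, Walk.length_edges]

theorem numOddCycles_eq_zero [Fintype V] (hG : G.IsBipartite) : G.numOddCycles = 0 := by
  rw [numOddCycles_eq_card, card_eq_zero, eq_empty_iff_forall_notMem]
  intro T hT
  obtain ⟨v, w, hw, ho, rfl⟩ := mem_oddCycleEdgeFinsets.1 hT
  exact Nat.not_even_iff_odd.2 ho (two_colorable_iff_forall_loop_even.1 hG v w)

theorem Walk.IsCycle.card_support_toFinset {u : V} {w : G.Walk u u} (hw : w.IsCycle) :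
    w.length ≤ #w.support.toFinset := by
  have h : #w.support.tail.toFinset = w.length := by
    rw [List.toFinset_card_of_nodup hw.support_nodup]
    simp
  rw [← h]
  refine card_le_card fun x hx => ?_
  rw [List.mem_toFinset] at hx ⊢
  exact List.mem_of_mem_tail hx

variable [DecidableRel G.Adj] {R : Type*} [CommRing R]

theorem incMatrix_col_of_adj {a b : V} (h : G.Adj a b) :
    (fun v => G.incMatrix R v s(a, b)) = Pi.single a 1 + Pi.single b 1 := by
  ext v
  have hne := h.ne
  by_cases hva : v = a
  · subst hva
    simp [incMatrix_apply', h, hne]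
  · by_cases hvb : v = b
    · subst hvb
      simp [incMatrix_apply', mk'_mem_incidenceSet_iff, h, hne.symm]
    · simp [incMatrix_apply', mk'_mem_incidenceSet_iff, hva, hvb]

theorem incMatrix_int_ne_zero_iff {v : V} {e : Sym2 V} :
    G.incMatrix ℤ v e ≠ 0 ↔ e ∈ G.edgeSet ∧ v ∈ e := by
  rw [Ne, incMatrix_apply_eq_zero_iff, not_not]
  rfl

theorem cast_incMatrix (x : V) (e : Sym2 V) :
    ((G.incMatrix ℤ x e : ℤ) : R) = G.incMatrix R x e := by
  simp [incMatrix_apply']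

theorem exists_incMatrix_int_ne_zero_iff {e : Sym2 V} :
    (∃ v, G.incMatrix ℤ v e ≠ 0) ↔ e ∈ G.edgeSet := by
  simp only [incMatrix_int_ne_zero_iff]
  refine ⟨fun ⟨_, h⟩ => h.1, fun h => ?_⟩
  induction e with | _ a b => exact ⟨a, h, by simp⟩

/-- Distinct edges have distinct endpoint pairs. This is the non-proportionality needed for basis
exchange. -/
theorem exists_incMatrix_int_of_ne {e f : Sym2 V} (hf : f ∈ G.edgeSet) (hne : e ≠ f) :
    ∃ v, G.incMatrix ℤ v e = 0 ∧ G.incMatrix ℤ v f ≠ 0 := by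
  by_contra! h
  induction f with | _ a b =>
  have hab : a ≠ b := G.ne_of_adj hf
  have ha : a ∈ e := by
    by_contra hx
    exact incMatrix_int_ne_zero_iff.2 ⟨hf, by simp⟩
      (h a (by_contra fun h' => hx (incMatrix_int_ne_zero_iff.1 h').2))
  have hb : b ∈ e := by
    by_contra hx
    exact incMatrix_int_ne_zero_iff.2 ⟨hf, by simp⟩
      (h b (by_contra fun h' => hx (incMatrix_int_ne_zero_iff.1 h').2))
  exact hne (((Sym2.mem_and_mem_iff hab).1 ⟨ha, hb⟩))

theorem sum_mul_incMatrix_of_adj [Fintype V] (y : V → R) {a b : V} (h : G.Adj a b) :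
    ∑ v, G.incMatrix R v s(a, b) * y v = y a + y b := by
  have h' := fun v => congrFun (incMatrix_col_of_adj (R := R) h) v
  simp only [h', Pi.add_apply, add_mul, sum_add_distrib]
  simp [Pi.single_apply]

theorem sum_mul_incMatrix_of_notMem [Fintype V] (y : V → R) {e : Sym2 V} (h : e ∉ G.edgeSet) :
    ∑ v, G.incMatrix R v e * y v = 0 := by
  refine sum_eq_zero fun v _ => ?_
  rw [incMatrix_of_notMem_incidenceSet _ fun he => h he.1, zero_mul]

namespace Walk

/-- The alternating sum of the edge columns along the walk telescopes. -/
theorem single_sub_mem_span {u v : V} (w : G.Walk u v) :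
    (Pi.single u 1 - (-1) ^ w.length • Pi.single v 1 : V → R) ∈
      Submodule.span R ((fun e x => G.incMatrix R x e) '' {e | e ∈ w.edges}) := by
  induction w with
  | nil => simp
  | @cons a b c h p ih =>
    have h1 : (Pi.single a 1 + Pi.single b 1 : V → R) ∈ Submodule.span R
        ((fun e x => G.incMatrix R x e) '' {e | e ∈ (cons h p).edges}) := by
      rw [← incMatrix_col_of_adj h]
      exact Submodule.subset_span ⟨_, by simp, rfl⟩
    have h2 := Submodule.span_mono (R := R)
      (Set.image_mono (f := fun e x => G.incMatrix R x e)
        (show {e | e ∈ p.edges} ⊆ {e | e ∈ (cons h p).edges} from fun e he => by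
          simp only [Set.mem_ofPred_eq, edges_cons, List.mem_cons] at he ⊢
          exact Or.inr he)) ih
    convert Submodule.sub_mem _ h1 h2 using 1
    rw [length_cons, pow_succ]
    ext x
    simp only [Pi.sub_apply, Pi.add_apply, Pi.smul_apply]
    ring

/-- On an odd closed walk based at `v`, the two end terms of the telescoped sum add instead of
cancelling. -/
theorem two_smul_single_mem_span {u v : V} {w : G.Walk u u} (hw : Odd w.length)
    (hv : v ∈ w.support) :
    (2 • Pi.single v 1 : V → R) ∈
      Submodule.span R ((fun e x => G.incMatrix R x e) '' {e | e ∈ w.edges}) := by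
  have h := (w.rotate v hv).single_sub_mem_span (R := R)
  rw [length_rotate, hw.neg_one_pow] at h
  simp only [(w.rotate_edges v hv).mem_iff] at h
  convert h using 1
  simp [two_smul]

/-- After halving, the edge columns span the unit vector of every vertex on the cycle, so their rank
is at least the number of these vertices, which is at least the number of edges. -/
theorem IsCycle.linearIndepOn_incMatrix [Fintype V] {u : V} {w : G.Walk u u} (hw : w.IsCycle)
    (hodd : Odd w.length) :
    LinearIndepOn ℚ (fun e x => G.incMatrix ℚ x e) (w.edges.toFinset : Set (Sym2 V)) := by
  change LinearIndependent ℚ (fun e : w.edges.toFinset => fun x => G.incMatrix ℚ x e)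
  rw [linearIndependent_iff_card_le_finrank_span, Fintype.card_coe,
    List.toFinset_card_of_nodup hw.edges_nodup, length_edges]
  refine hw.card_support_toFinset.trans ?_
  have hind : LinearIndependent ℚ
      (fun v : w.support.toFinset => (Pi.single (v : V) 1 : V → ℚ)) :=
    (Pi.linearIndependent_single_one V ℚ).comp _ Subtype.val_injective
  have h := finrank_span_eq_card hind
  rw [Fintype.card_coe] at h
  rw [← h]
  refine Submodule.finrank_mono (Submodule.span_le.2 ?_)
  rintro _ ⟨⟨v, hv⟩, rfl⟩
  have h2 := two_smul_single_mem_span (R := ℚ) hodd (List.mem_toFinset.1 hv)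
  have h3 := Submodule.smul_mem _ (1 / 2 : ℚ) h2
  have h4 : (1 / 2 : ℚ) • (2 • Pi.single v 1 : V → ℚ) = Pi.single v 1 := by
    ext x
    simp
  rw [h4, Set.image_eq_range] at h3
  refine Submodule.span_mono ?_ h3
  rintro _ ⟨⟨e, he⟩, rfl⟩
  exact ⟨⟨e, List.mem_toFinset.2 he⟩, rfl⟩

/-- Each passage through an interior vertex uses two edges, so modulo 2 only the ends of the walk
survive. -/
theorem two_dvd_sum_edges {u v : V} (w : G.Walk u v) (x : V) :
    (2 : ℤ) ∣ (w.edges.map (G.incMatrix ℤ x)).sum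
      - (Pi.single u 1 : V → ℤ) x - (Pi.single v 1 : V → ℤ) x := by
  induction w with
  | nil => exact ⟨-(Pi.single _ 1 : V → ℤ) x, by simp; ring⟩
  | cons h p ih =>
    have h1 := congrFun (incMatrix_col_of_adj (R := ℤ) h) x
    simp only [edges_cons, List.map_cons, List.sum_cons]
    rw [h1, Pi.add_apply]
    omega

theorem IsCycle.two_dvd_sum_edges {u : V} {w : G.Walk u u} (hw : w.IsCycle) (x : V) :
    (2 : ℤ) ∣ ∑ e ∈ w.edges.toFinset, G.incMatrix ℤ x e := by
  rw [List.sum_toFinset _ hw.edges_nodup]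
  obtain ⟨k, hk⟩ := Walk.two_dvd_sum_edges w x
  exact ⟨(Pi.single u 1 : V → ℤ) x + k, by linarith⟩

end Walk

theorem span_incMatrix_eq_top [Fintype V]
    (hG : ∀ c : G.ConnectedComponent, ¬ c.toSimpleGraph.IsBipartite) :
    Submodule.span ℚ (Set.range fun e x => G.incMatrix ℚ x e) = ⊤ := by
  rw [eq_top_iff, ← (Pi.basisFun ℚ V).span_eq, Submodule.span_le]
  rintro _ ⟨v, rfl⟩
  obtain ⟨w, hw⟩ := exists_odd_closed_walk hG v
  have h2 := Walk.two_smul_single_mem_span (R := ℚ) hw w.start_mem_support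
  have h3 := Submodule.span_mono (Set.image_subset_range _ _) (Submodule.smul_mem _ (1 / 2 : ℚ) h2)
  have h4 : (1 / 2 : ℚ) • (2 • Pi.single v 1 : V → ℚ) = Pi.basisFun ℚ V v := by
    ext x
    simp
  rwa [h4] at h3

section

variable [Fintype V]

theorem two_dvd_sum_of_mem_oddCycleEdgeFinsets {T : Finset (Sym2 V)} (hT : T ∈ G.oddCycleEdgeFinsets) (x : V) :
    (2 : ℤ) ∣ ∑ e ∈ T, G.incMatrix ℤ x e := by
  obtain ⟨v, w, hw, ho, rfl⟩ := mem_oddCycleEdgeFinsets.1 hT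
  exact hw.two_dvd_sum_edges x

theorem exists_isColBasis_superset
    (hG : ∀ c : G.ConnectedComponent, ¬ c.toSimpleGraph.IsBipartite) {T : Finset (Sym2 V)}
    (hT : T ∈ G.oddCycleEdgeFinsets) : ∃ S, (G.incMatrix ℤ).IsColBasis S ∧ T ⊆ S := by
  obtain ⟨v, w, hw, ho, rfl⟩ := mem_oddCycleEdgeFinsets.1 hT
  apply exists_isColBasis_of_linearIndepOn
  · simpa only [cast_incMatrix] using hw.linearIndepOn_incMatrix ho
  · simpa only [cast_incMatrix] using span_incMatrix_eq_top hG

theorem exists_isColBasis (hG : ∀ c : G.ConnectedComponent, ¬ c.toSimpleGraph.IsBipartite) :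
    ∃ S, (G.incMatrix ℤ).IsColBasis S := by
  obtain ⟨S, hS, -⟩ := exists_isColBasis_of_linearIndepOn (B := G.incMatrix ℤ) (T := ∅)
    (by simp) (by simpa only [cast_incMatrix] using span_incMatrix_eq_top hG)
  exact ⟨S, hS⟩

theorem det_signlessLapMatrix :
    (G.signlessLapMatrix ℝ).det = ((G.incMatrix ℤ * (G.incMatrix ℤ)ᵀ).det : ℤ) := by
  rw [Int.cast_det]
  congr 1
  ext a b
  rw [incMatrix_mul_transpose]
  by_cases hab : a = b
  · subst hab
    simp [signlessLapMatrix, degMatrix]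
  · by_cases h : G.Adj a b <;> simp [signlessLapMatrix, degMatrix, hab, h]

theorem det_incMatrix_mul_transpose_eq_zero [Nonempty V] (hG : G.IsBipartite) :
    (G.incMatrix ℤ * (G.incMatrix ℤ)ᵀ).det = 0 := by
  obtain ⟨c⟩ := hG
  -- The sign vector of the bipartition is orthogonal to every edge column.
  let y : V → ℤ := fun v => if c v = 0 then 1 else -1
  refine exists_vecMul_eq_zero_iff.1 ⟨y, ?_, ?_⟩
  · obtain ⟨v⟩ := ‹Nonempty V›
    intro h
    have := congrFun h v
    simp only [y, Pi.zero_apply] at this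
    split_ifs at this
    simp at this
  · have hy : y ᵥ* G.incMatrix ℤ = 0 := by
      ext e
      have : (y ᵥ* G.incMatrix ℤ) e = ∑ v, G.incMatrix ℤ v e * y v := by
        simp [vecMul, dotProduct, mul_comm]
      rw [this, Pi.zero_apply]
      by_cases he : e ∈ G.edgeSet
      · induction e with | _ a b =>
        have hne : c a ≠ c b := c.valid he
        have hsum : y a + y b = 0 := by
          simp only [y]
          split_ifs
          all_goals omega
        exact (sum_mul_incMatrix_of_adj y he).trans hsum
      · exact sum_mul_incMatrix_of_notMem y he
    rw [← vecMul_vecMul, hy, zero_vecMul]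

end

-- A determinant bound from the integer column span.

end SimpleGraph

namespace Matrix

open Finset

variable {V E : Type*} [Fintype V] [DecidableEq V]

/-- If the integer span of the columns of `M` contains `2 • single r 1` and, for every `v`, one of
`single v 1 ± single r 1`, then `det M` divides `2`. -/
theorem det_dvd_two {M : Matrix V V ℤ} {r : V} (ε : V → ℤ) (hr : ε r = -1)
    (h : ∀ v, (Pi.single v 1 - ε v • Pi.single r 1 : V → ℤ) ∈
      Submodule.span ℤ (Set.range M.col)) : M.det ∣ 2 := by
  rw [← range_mulVecLin] at h
  choose c hc using h
  let N : Matrix V V ℤ := of fun i v => c v i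
  -- `M * N` is a rank-one perturbation of the identity, so the matrix determinant lemma gives it
  -- determinant `1 - ε r = 2`.
  have hMN : M * N = 1 + replicateCol Unit (Pi.single r 1 : V → ℤ) * replicateRow Unit (-ε) := by
    ext i v
    have h1 : (M * N) i v = (M *ᵥ c v) i := rfl
    have h2 := congrFun (hc v) i
    rw [mulVecLin_apply] at h2
    rw [h1, h2, add_apply, mul_apply, one_apply]
    simp [Pi.single_apply]
    ring
  have hdet := congrArg det hMN
  rw [det_mul, det_one_add_replicateCol_mul_replicateRow] at hdet
  refine ⟨N.det, ?_⟩
  rw [hdet]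
  simp [hr]

end Matrix

/-! ### Connectedness, odd-unicyclic graphs and the equality case. -/

namespace SimpleGraph

open Finset Matrix

theorem IsOddUnicyclic.numOddCycles_eq_one {V : Type*} {G : SimpleGraph V}
    (hG : G.IsOddUnicyclic) : G.numOddCycles = 1 := by
  obtain ⟨-, C, hC, huniq⟩ := hG
  rw [numOddCycles, Set.ncard_eq_one]
  refine ⟨C, Set.eq_singleton_iff_unique_mem.2 ⟨hC, ?_⟩⟩
  rintro C' ⟨v, w, hw, -, rfl⟩
  exact huniq _ ⟨v, w, hw, rfl⟩

variable {V : Type*} [Fintype V] [DecidableEq V] {G : SimpleGraph V} [DecidableRel G.Adj]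

theorem subset_edgeFinset_of_isColBasis {S : Finset (Sym2 V)}
    (hS : (G.incMatrix ℤ).IsColBasis S) : S ⊆ G.edgeFinset := fun _ he =>
  mem_edgeFinset.2 (exists_incMatrix_int_ne_zero_iff.1 (hS.exists_ne_zero he))

/-- If the incidence matrix has a column basis of determinant `±2`, then the graph is connected. -/
theorem preconnected_of_gramMinor_eq_four {S : Finset (Sym2 V)}
    (hS : (G.incMatrix ℤ).IsColBasis S) (h4 : (G.incMatrix ℤ).gramMinor S = 4) :
    G.Preconnected := by
  classical
  obtain ⟨p, hp, hpS, h0⟩ := hS.exists_fun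
  rw [gramMinor_eq_det_sq _ hp hpS] at h4
  set M := (G.incMatrix ℤ).submatrix id p
  have hcard := card_ker_mod_two_le Mᵀ (by rwa [det_transpose])
  rw [det_transpose] at hcard
  have h2 : M.det.natAbs ≤ 2 := by
    have := Int.natAbs_sq M.det
    rw [h4] at this
    zify at this ⊢
    nlinarith [abs_nonneg M.det]
  intro u v
  by_contra huv
  -- Vectors constant on the component of `u` and on its complement. Each edge has both ends on one
  -- side, so they lie in the kernel of `Mᵀ` modulo 2; three distinct ones exceed the bound `|det M|
  -- ≤ 2`.
  let y : Bool → Bool → V → ZMod 2 := fun b b' x =>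
    if G.Reachable u x then (if b then 1 else 0) else (if b' then 1 else 0)
  have hker : ∀ b b', y b b' ∈
      ({y : V → ZMod 2 | Mᵀ.map (Int.cast : ℤ → ZMod 2) *ᵥ y = 0} : Finset _) := by
    intro b b'
    rw [mem_filter]
    refine ⟨mem_univ _, funext fun i => ?_⟩
    have h1 : (Mᵀ.map (Int.cast : ℤ → ZMod 2) *ᵥ y b b') i =
        ∑ x, G.incMatrix (ZMod 2) x (p i) * y b b' x := by
      simp [mulVec, dotProduct, M, cast_incMatrix]
    rw [h1, Pi.zero_apply]
    by_cases he : p i ∈ G.edgeSet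
    · induction hpi : p i with | _ a c =>
      have hac : G.Adj a c := by rwa [hpi] at he
      have hy : y b b' a = y b b' c := by
        have : G.Reachable u a ↔ G.Reachable u c :=
          ⟨fun h => h.trans hac.reachable, fun h => h.trans hac.symm.reachable⟩
        simp only [y, this]
      refine (sum_mul_incMatrix_of_adj _ hac).trans ?_
      rw [hy]
      exact CharTwo.add_self_eq_zero _
    · exact sum_mul_incMatrix_of_notMem _ he
  have hu : ∀ b b', y b b' u = if b then 1 else 0 := fun b b' => if_pos (Reachable.refl u)
  have hv : ∀ b b', y b b' v = if b' then 1 else 0 := fun b b' => if_neg huv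
  have h3 : #{y false false, y true false, y false true} = 3 := by
    refine card_eq_three.2 ⟨_, _, _, ?_, ?_, ?_, rfl⟩
    · intro h
      have := congrFun h u
      simp [hu] at this
    · intro h
      have := congrFun h v
      simp [hv] at this
    · intro h
      have := congrFun h u
      simp [hu] at this
  have hle := card_le_card (s := {y false false, y true false, y false true}) fun z hz => by
    simp only [mem_insert, mem_singleton] at hz
    rcases hz with rfl | rfl | rfl <;> exact hker _ _
  omega

/-- A connected graph with an odd cycle and no other cycle has as many edges as vertices. -/
theorem IsOddUnicyclic.card_edgeFinset (hG : G.IsOddUnicyclic) :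
    #G.edgeFinset = Fintype.card V := by
  obtain ⟨hconn, _, ⟨v, w, hw, -, rfl⟩, huniq⟩ := hG
  obtain ⟨e, he⟩ : ∃ e, e ∈ w.edges := List.exists_mem_of_ne_nil _ fun h =>
    hw.not_nil (Walk.edges_eq_nil.1 h)
  have heG : e ∈ G.edgeSet := w.edges_subset_edgeSet he
  have hnb : ¬ G.IsBridge e := fun h => h.notMem_edges_of_isCycle hw he
  -- Deleting a cycle edge keeps the graph connected, and any surviving cycle would be the unique
  -- one, which contains `e`.
  have htree : (G.deleteEdges {e}).IsTree := by
    constructor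
    · induction e with | _ a b => exact hconn.connected_delete_edge_of_not_isBridge hnb
    · intro u c hc
      have hc' := hc.mapLe (G.deleteEdges_le {e})
      have heq := huniq _ ⟨_, _, hc', rfl⟩
      have hmem : e ∈ (c.mapLe (G.deleteEdges_le {e})).edges := by
        rw [← Walk.mem_edges_toSubgraph, heq, Walk.mem_edges_toSubgraph]
        exact he
      rw [Walk.edges_mapLe_eq_edges] at hmem
      have := c.edges_subset_edgeSet hmem
      simp at this
  have hcard := htree.card_edgeFinset
  have hins : insert e (G.deleteEdges {e}).edgeFinset = G.edgeFinset := by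
    ext f
    simp only [mem_insert, mem_edgeFinset, edgeSet_deleteEdges, Set.mem_sdiff,
      Set.mem_singleton_iff]
    by_cases hfe : f = e
    · simp [hfe, heG]
    · simp [hfe]
  rw [← hins, card_insert_of_notMem (by simp), hcard]

theorem IsOddUnicyclic.det_le_four (hG : G.IsOddUnicyclic) :
    (G.incMatrix ℤ * (G.incMatrix ℤ)ᵀ).det ≤ 4 := by
  have hcard := hG.card_edgeFinset
  obtain ⟨hconn, _, ⟨r, w, hw, ho, rfl⟩, -⟩ := hG
  have hle : (G.incMatrix ℤ * (G.incMatrix ℤ)ᵀ).det ≤ (G.incMatrix ℤ).gramMinor G.edgeFinset := by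
    -- A basis consists of `|V|` edges and there are only `|V|` edges, so the full edge set is the
    -- only candidate.
    rw [det_mul_transpose_eq_sum_colBases, ← sum_singleton (G.incMatrix ℤ).gramMinor]
    refine sum_le_sum_of_subset_of_nonneg (fun S hS => ?_) fun S hS _ => ?_
    · have hS := mem_colBases.1 hS
      rw [mem_singleton]
      exact eq_of_subset_of_card_le (subset_edgeFinset_of_isColBasis hS) (by rw [hcard, hS.1])
    · rw [mem_singleton.1 hS]
      exact gramMinor_nonneg hcard
  refine hle.trans ?_
  obtain ⟨p, hp, hpS⟩ := exists_injective_image_eq hcard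
  rw [gramMinor_eq_det_sq _ hp hpS]
  have hspan : ∀ {u v : V} (q : G.Walk u v),
      (Pi.single u 1 - (-1) ^ q.length • Pi.single v 1 : V → ℤ) ∈
        Submodule.span ℤ (Set.range ((G.incMatrix ℤ).submatrix id p).col) := by
    intro u v q
    refine Submodule.span_mono ?_ q.single_sub_mem_span
    rintro _ ⟨e, he, rfl⟩
    have heG := mem_edgeFinset.2 (q.edges_subset_edgeSet he)
    rw [← hpS] at heG
    obtain ⟨i, -, rfl⟩ := mem_image.1 heG
    exact ⟨i, rfl⟩
  -- At `v = r` the odd cycle replaces the empty walk, so that the sign at `r` is `-1`, as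
  -- `det_dvd_two` requires.
  have hwalk : ∀ v, ∃ q : G.Walk v r, v = r → Odd q.length := fun v => by
    by_cases hv : v = r
    · subst hv
      exact ⟨w, fun _ => ho⟩
    · obtain ⟨q⟩ := hconn.preconnected v r
      exact ⟨q, fun h => (hv h).elim⟩
  choose q hq using hwalk
  have hdvd := det_dvd_two (fun v => (-1) ^ (q v).length) ((hq r rfl).neg_one_pow)
    fun v => hspan (q v)
  have hnat := Nat.le_of_dvd two_pos (Int.natAbs_dvd_natAbs.2 hdvd)
  rw [← Int.natAbs_sq]
  exact_mod_cast Nat.pow_le_pow_left hnat 2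

theorem four_mul_card_oddCycleEdgeFinsets_le_det
    (hG : ∀ c : G.ConnectedComponent, ¬ c.toSimpleGraph.IsBipartite) :
    4 * (#G.oddCycleEdgeFinsets : ℤ) ≤ (G.incMatrix ℤ * (G.incMatrix ℤ)ᵀ).det :=
  four_mul_card_le_det (fun _ => odd_card_of_mem_oddCycleEdgeFinsets)
    (fun _ => two_dvd_sum_of_mem_oddCycleEdgeFinsets) (fun _ => exists_isColBasis_superset hG)

theorem isOddUnicyclic_of_four_mul_card_eq_det [Nonempty V]
    (hG : ∀ c : G.ConnectedComponent, ¬ c.toSimpleGraph.IsBipartite)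
    (heq : 4 * (#G.oddCycleEdgeFinsets : ℤ) = (G.incMatrix ℤ * (G.incMatrix ℤ)ᵀ).det) :
    G.IsOddUnicyclic := by
  have hodd : ∀ T ∈ G.oddCycleEdgeFinsets, Odd #T :=
    fun _ => odd_card_of_mem_oddCycleEdgeFinsets
  have heven : ∀ T ∈ G.oddCycleEdgeFinsets, ∀ x, (2 : ℤ) ∣ ∑ e ∈ T, G.incMatrix ℤ x e :=
    fun _ => two_dvd_sum_of_mem_oddCycleEdgeFinsets
  have hbasis := fun T => exists_isColBasis_superset hG (T := T)
  obtain ⟨S, hS⟩ := exists_isColBasis hG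
  obtain ⟨hone, h4⟩ := (of_four_mul_card_eq_det hodd heven hbasis heq).1 S hS
  refine ⟨⟨preconnected_of_gramMinor_eq_four hS h4⟩, ?_⟩
  have hmemS : ∀ e ∈ G.edgeSet, e ∈ S := fun e he =>
    mem_of_four_mul_card_eq_det hodd heven hbasis heq
      (fun f hf e hne => exists_incMatrix_int_of_ne (exists_incMatrix_int_ne_zero_iff.1 hf) hne) hS
      (exists_incMatrix_int_ne_zero_iff.2 he)
  have hK : #((G.incMatrix ℤ).evenSets S) ≤ 2 := by
    have := hS.sq_card_evenSets_le
    rw [h4] at this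
    zify
    nlinarith
  have hcycle : ∀ {u : V} {c : G.Walk u u}, c.IsCycle →
      c.edges.toFinset ∈ ((G.incMatrix ℤ).evenSets S).erase ∅ := by
    intro u c hc
    rw [mem_erase, mem_evenSets]
    refine ⟨fun h => hc.not_nil ?_, fun e he => ?_, hc.two_dvd_sum_edges⟩
    · exact Walk.edges_eq_nil.1 (List.toFinset_eq_empty_iff _ |>.1 h)
    · exact hmemS e (c.edges_subset_edgeSet (List.mem_toFinset.1 he))
  -- Since `S` contains every edge, each cycle is a nonempty even set of `S`; at most two even sets
  -- exist and one is empty.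
  have hK' : #(((G.incMatrix ℤ).evenSets S).erase ∅) ≤ 1 := by
    rw [card_erase_of_mem (mem_evenSets.2 ⟨empty_subset _, by simp⟩)]
    omega
  obtain ⟨T, hT⟩ := card_pos.1 (hone ▸ one_pos)
  obtain ⟨v, w, hw, ho, -⟩ := mem_oddCycleEdgeFinsets.1 (mem_filter.1 hT).1
  refine ⟨w.toSubgraph, ⟨v, w, hw, ho, rfl⟩, ?_⟩
  rintro _ ⟨u, c, hc, rfl⟩
  refine hc.toSubgraph_eq_of_edges hw fun e => ?_
  rw [← List.mem_toFinset, card_le_one.1 hK' _ (hcycle hc) _ (hcycle hw), List.mem_toFinset]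

end SimpleGraph

theorem mainTheorem3 {V : Type*} [Fintype V] [DecidableEq V] [Nonempty V]
    (G : SimpleGraph V) [DecidableRel G.Adj]
    (hG : G.IsBipartite ∨ ∀ c : G.ConnectedComponent, ¬ c.toSimpleGraph.IsBipartite) :
    (G.numOddCycles : ℝ) ≤ (G.signlessLapMatrix ℝ).det / 4 ∧
      ((G.numOddCycles : ℝ) = (G.signlessLapMatrix ℝ).det / 4 ↔
        G.IsBipartite ∨ G.IsOddUnicyclic) := by
  rw [SimpleGraph.det_signlessLapMatrix]
  rcases hG with hG | hG
  · rw [SimpleGraph.det_incMatrix_mul_transpose_eq_zero hG, SimpleGraph.numOddCycles_eq_zero hG]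
    simp [hG]
  · have hle := SimpleGraph.four_mul_card_oddCycleEdgeFinsets_le_det hG
    rw [← SimpleGraph.numOddCycles_eq_card] at hle
    have hle' : (4 : ℝ) * (G.numOddCycles : ℝ) ≤
        ((G.incMatrix ℤ * (G.incMatrix ℤ).transpose).det : ℤ) := by exact_mod_cast hle
    refine ⟨by linarith, fun h => Or.inr ?_, ?_⟩
    · refine SimpleGraph.isOddUnicyclic_of_four_mul_card_eq_det hG ?_
      rw [← SimpleGraph.numOddCycles_eq_card]
      have : (4 : ℝ) * (G.numOddCycles : ℝ) =
        ((G.incMatrix ℤ * (G.incMatrix ℤ).transpose).det : ℤ) := by linarith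
      exact_mod_cast this
    · rintro (hb | hu)
      · rw [SimpleGraph.det_incMatrix_mul_transpose_eq_zero hb,
          SimpleGraph.numOddCycles_eq_zero hb]
        simp
      · rw [hu.numOddCycles_eq_one] at hle ⊢
        -- The main inequality with one odd cycle supplies the lower bound 4, so no minor has to be
        -- computed exactly.
        have h4 : (G.incMatrix ℤ * (G.incMatrix ℤ).transpose).det = 4 :=
          le_antisymm hu.det_le_four (by simpa using hle)
        rw [h4]
        norm_num
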